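/- For $r\ge 0$ let $U_r:\mathbb R\to\mathbb R$ be the shrinking operator $U_r(0)=0$, $U_r(x)=\max\{|x|-r,0\}\,x/|x|$ for $x\ne 0$. For $\sigma$-fields $\mathcal A,\mathcal B$ on a probability space $(\Omega,\mathcal F,P)$ let $$\alpha(\mathcal A,\mathcal B)=\sup_{A\in\mathcal A,\,B\in\mathcal B}|P(A\cap B)-P(A)P(B)|,\qquad \rho(\mathcal A,\mathcal B)=\sup\{|\mathrm{Corr}(f,g)|: f\in L_2(\mathcal A),\ g\in L_2(\mathcal B)\},$$ where $\mathrm{Corr}(f,g)=0$ if $f$ or $g$ is almost surely constant. For a sequence $X=(X_k)_{k\in\mathbb Z}$ of real random variables and $n\ge 1$ let $\alpha(X,n)=\alpha(\sigma(X_k,k\le 0),\sigma(X_k,k\ge n))$ and $\rho^*(X,n)=\sup\rho(\sigma(X_k,k\in S),\sigma(X_k,k\in T))$, the supremum being over all nonempty disjoint $S,T\subset\mathbb Z$ with $\min_{s\in S,t\in T}|s-t|\ge n$. Put $G(r)=\int_0^\infty t\,P(|X_0|>t+r)\,dt$ for $r\ge 0$. **Theorem 2.2.** Let $0<\lambda<1$.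 There exists a strictly stationary sequence $X=(X_k)_{k\in\mathbb Z}$ of real random variables on some probability space such that $0<G(r)<\infty$ for all $r\ge 0$, such that $\lim_{r\to\infty}G(r+\varepsilon)/G(r)=0$ for every $\varepsilon>0$, and such that: (a) $\alpha(X,1)\le\lambda$; (b) for some $c>0$, $\rho^*(X,n)=O(e^{-cn})$ as $n\to\infty$; (c) for every $r>0$ and every integer $n\ge 1$, $P\big(\sum_{k=1}^n U_r(X_k)=0\big)\ge 1-\lambda$. In particular no central limit theorem holds for the shrunken sums: for all real sequences $(r(n))$, $(a_n)$, $(b_n)$ with every $r(n)>0$, the variables $a_n\sum_{k=1}^n U_{r(n)}(X_k)-b_n$ do not converge in distribution to any normal law with positive variance. -/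

import Mathlib

open MeasureTheory ProbabilityTheory Filter Topology
open scoped ENNReal NNReal

noncomputable section

namespace Shrunken

/-- The shrinking operator `U_r` on the real line. -/
def shrink (r x : ℝ) : ℝ := if x = 0 then 0 else max (|x| - r) 0 * (x / |x|)

/-- Strict stationarity of a two-sided sequence: any two blocks of consecutive variables of the
same length have the same distribution. -/
def StrictlyStationary {Ω : Type*} [MeasurableSpace Ω] (P : Measure Ω) (X : ℤ → Ω → ℝ) : Prop :=
  ∀ (j l : ℤ) (m : ℕ),
    P.map (fun ω => fun i : Fin (m + 1) => X (j + (i : ℤ)) ω) =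
      P.map (fun ω => fun i : Fin (m + 1) => X (l + (i : ℤ)) ω)

/-- `σ(X_k, k ∈ S)`. -/
abbrev sigmaGen {Ω : Type*} (X : ℤ → Ω → ℝ) (S : Set ℤ) : MeasurableSpace Ω :=
  ⨆ k ∈ S, MeasurableSpace.comap (X k) inferInstance

/-- The Pearson correlation `Cov(f, g) / (‖f - E f‖₂ ‖g - E g‖₂)`, equal to `0` if `f` or `g` is
almost surely constant. -/
def corr {Ω : Type*} [MeasurableSpace Ω] (P : Measure Ω) (f g : Ω → ℝ) : ℝ :=
  covariance f g P / (√(variance f P) * √(variance g P))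

/-- The strong mixing coefficient `α(𝒜, ℬ)` of two sub-σ-fields. -/
def alphaCoeff {Ω : Type*} (𝒜 ℬ : MeasurableSpace Ω) {mΩ : MeasurableSpace Ω}
    (P : Measure Ω) : ℝ :=
  sSup {x : ℝ | ∃ A B : Set Ω, MeasurableSet[𝒜] A ∧ MeasurableSet[ℬ] B ∧
    x = |P.real (A ∩ B) - P.real A * P.real B|}

/-- The maximal correlation coefficient `ρ(𝒜, ℬ)` of two sub-σ-fields. -/
def rhoCoeff {Ω : Type*} (𝒜 ℬ : MeasurableSpace Ω) {mΩ : MeasurableSpace Ω}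
    (P : Measure Ω) : ℝ :=
  sSup {x : ℝ | ∃ f g : Ω → ℝ, Measurable[𝒜] f ∧ MemLp f 2 P ∧ Measurable[ℬ] g ∧ MemLp g 2 P ∧
    x = |corr P f g|}

/-- `α(X, n) = α(σ(X_k, k ≤ 0), σ(X_k, k ≥ n))`. -/
def alphaMix {Ω : Type*} [MeasurableSpace Ω] (P : Measure Ω) (X : ℤ → Ω → ℝ) (n : ℕ) : ℝ :=
  alphaCoeff (sigmaGen X {k | k ≤ 0}) (sigmaGen X {k | (n : ℤ) ≤ k}) P

/-- `ρ*(X, n)`: the supremum of `ρ(σ(X_k, k ∈ S), σ(X_k, k ∈ T))` over nonempty disjoint sets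
`S, T` of integers at distance at least `n`. -/
def rhoStar {Ω : Type*} [MeasurableSpace Ω] (P : Measure Ω) (X : ℤ → Ω → ℝ) (n : ℕ) : ℝ :=
  sSup {x : ℝ | ∃ S T : Set ℤ, S.Nonempty ∧ T.Nonempty ∧ Disjoint S T ∧
    (∀ s ∈ S, ∀ t ∈ T, (n : ℤ) ≤ |s - t|) ∧ x = rhoCoeff (sigmaGen X S) (sigmaGen X T) P}

/-- `G(r) = ∫₀^∞ t P(|Y| > t + r) dt`, as an element of `[0, ∞]`. -/
def tailG {Ω : Type*} [MeasurableSpace Ω] (P : Measure Ω) (Y : Ω → ℝ) (r : ℝ) : ℝ≥0∞ :=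
  ∫⁻ t in Set.Ioi (0 : ℝ), ENNReal.ofReal t * P {ω | t + r < |Y ω|}

/-- The sum `U_r(X_1) + ⋯ + U_r(X_n)`. -/
def shrunkenSum {Ω : Type*} (X : ℤ → Ω → ℝ) (r : ℝ) (n : ℕ) (ω : Ω) : ℝ :=
  ∑ k ∈ Finset.Icc 1 n, shrink r (X (k : ℤ) ω)

/-! The suprema above are taken over nonempty sets of reals that are bounded by `1`. -/

lemma abs_corr_le_one {Ω : Type*} [MeasurableSpace Ω] (P : Measure Ω) [IsProbabilityMeasure P]
    {f g : Ω → ℝ} (hf : MemLp f 2 P) (hg : MemLp g 2 P) : |corr P f g| ≤ 1 := by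
  have hf' : MemLp (fun ω => f ω - ∫ a, f a ∂P) 2 P := hf.sub (memLp_const _)
  have hg' : MemLp (fun ω => g ω - ∫ a, g a ∂P) 2 P := hg.sub (memLp_const _)
  have h1 : |covariance f g P| ≤ √(variance f P) * √(variance g P) := by
    have h2 : |covariance f g P| ≤
        ∫ ω, ‖f ω - ∫ a, f a ∂P‖ * ‖g ω - ∫ a, g a ∂P‖ ∂P := by
      unfold covariance
      refine (abs_integral_le_integral_abs).trans (le_of_eq ?_)
      congr 1
      ext ω
      rw [abs_mul, Real.norm_eq_abs, Real.norm_eq_abs]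
    refine h2.trans ?_
    have h3 := integral_mul_norm_le_Lp_mul_Lq (μ := P) Real.HolderConjugate.two_two
      (by simpa using hf') (by simpa using hg')
    refine h3.trans (le_of_eq ?_)
    rw [variance_eq_integral hf.aemeasurable, variance_eq_integral hg.aemeasurable,
      Real.sqrt_eq_rpow, Real.sqrt_eq_rpow]
    simp
  unfold corr
  rw [abs_div, abs_of_nonneg (by positivity : 0 ≤ √(variance f P) * √(variance g P))]
  exact div_le_one_of_le₀ h1 (by positivity)

lemma rhoCoeff_le_one {Ω : Type*} (𝒜 ℬ : MeasurableSpace Ω) {mΩ : MeasurableSpace Ω}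
    (P : Measure Ω) [IsProbabilityMeasure P] : rhoCoeff 𝒜 ℬ P ≤ 1 := by
  refine Real.sSup_le ?_ zero_le_one
  rintro x ⟨f, g, -, hf, -, hg, rfl⟩
  exact abs_corr_le_one P hf hg

end Shrunken

end

namespace Shrunken

/-! ### The shrinking operator -/

/-! The example is a coboundary that survives shrinking. Take i.i.d. `ω k`, zero with probability `1
- p` and otherwise the square root of a standard exponential. Let `Y k` be `ω k` if `ω (k - 1) = 0`,
and `0` otherwise, and put `X k = Y k - Y (k - 1)`. Consecutive `Y`s are never both nonzero, so the
nonlinear `U_r` splits over each difference and the shrunken sum telescopes to `U_r (Y n) - U_r (Y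
0)` (`shrunkenSum_isolatedDiff`). This vanishes when `ω 0 = ω n = 0`, hence with probability at
least `1 - 2p`. The normalized sums then carry an atom of at least that mass, which no atomless weak
limit permits.

Mixing: `X k` is a function of `ω (k - 2), ω (k - 1), ω k`, so index sets at distance at least 3
give independent σ-fields. For `α`, on `ω 0 = 0` the future `X k`, `k ≥ 1`, is a function of `ω j`,
`j ≥ 1`, alone, which costs at most `2p`. The choice `p = λ / 2` serves both bounds. The tail of `|X
0|` is a constant times `exp (-s ^ 2)`, light enough for the condition on `G`. -/

@[simp] lemma shrink_zero (r : ℝ) : shrink r 0 = 0 := if_pos rfl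

lemma shrink_neg (r x : ℝ) : shrink r (-x) = -shrink r x := by
  unfold shrink
  split_ifs <;> simp_all [neg_div]

lemma shrink_sub_of_mul_eq_zero (r : ℝ) {a b : ℝ} (h : a * b = 0) :
    shrink r (a - b) = shrink r a - shrink r b := by
  rcases mul_eq_zero.1 h with rfl | rfl <;> simp [shrink_neg]

/-! ### Weak limits of laws with large atoms -/

/-- Closed balls around a point shrink to a null singleton, so small ones have measure below `η`.
Finitely many of them cover a large compact ball, and tightness makes the complement of that ball
small. -/
lemma exists_finite_closed_cover_measure_lt (ν : Measure ℝ) [IsFiniteMeasure ν]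
    (hν : ∀ x, ν {x} = 0) {η : ℝ≥0∞} (hη : 0 < η) :
    ∃ 𝒞 : Set (Set ℝ), 𝒞.Finite ∧ (∀ F ∈ 𝒞, IsClosed F ∧ ν F < η) ∧ ⋃₀ 𝒞 = Set.univ := by
  have hball : ∀ x : ℝ, ∃ δ > 0, ν (Metric.closedBall x δ) < η := by
    intro x
    have h := tendsto_measure_cthickening_of_isClosed (μ := ν) (s := {x})
      ⟨1, one_pos, measure_ne_top _ _⟩ isClosed_singleton
    rw [hν] at h
    have h2 : ∀ᶠ r in 𝓝[>] (0 : ℝ), ν (Metric.cthickening r {x}) < η :=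
      (h.mono_left nhdsWithin_le_nhds).eventually_lt_const hη
    obtain ⟨δ, hδ, hδ0⟩ := (h2.and self_mem_nhdsWithin).exists
    exact ⟨δ, hδ0, by rwa [Metric.cthickening_singleton x (le_of_lt hδ0)] at hδ⟩
  choose δ hδ0 hδ using hball
  obtain ⟨K, -, hK, hKη⟩ :=
    MeasurableSet.univ.exists_isCompact_sdiff_lt (μ := ν) (measure_ne_top _ _) hη.ne'
  obtain ⟨R, hR⟩ := hK.isBounded.subset_ball 0
  obtain ⟨t, -, ht⟩ := (isCompact_closedBall (0 : ℝ) R).elim_nhds_subcover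
    (fun x => Metric.closedBall x (δ x)) (fun x _ => Metric.closedBall_mem_nhds x (hδ0 x))
  refine ⟨insert (Metric.ball 0 R)ᶜ ((fun x => Metric.closedBall x (δ x)) '' t),
    (t.finite_toSet.image _).insert _, ?_, ?_⟩
  · rintro F (rfl | ⟨x, -, rfl⟩)
    · refine ⟨Metric.isOpen_ball.isClosed_compl, (measure_mono ?_).trans_lt hKη⟩
      exact fun x hx => ⟨trivial, fun hxK => hx (hR hxK)⟩
    · exact ⟨Metric.isClosed_closedBall, hδ x⟩
  · refine Set.eq_univ_of_forall fun x => ?_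
    by_cases hx : x ∈ Metric.ball (0 : ℝ) R
    · obtain ⟨y, hy, hxy⟩ := Set.mem_iUnion₂.1 (ht (Metric.ball_subset_closedBall hx))
      exact ⟨_, Or.inr ⟨y, hy, rfl⟩, hxy⟩
    · exact ⟨_, Or.inl rfl, hx⟩

/-- Laws carrying an atom of mass at least `η > 0` do not converge weakly to an atomless law. -/
lemma not_tendsto_of_le_measure_singleton {ν : ProbabilityMeasure ℝ}
    (hν : ∀ x, (ν : Measure ℝ) {x} = 0) {νs : ℕ → ProbabilityMeasure ℝ} {c : ℕ → ℝ}
    {η : ℝ≥0∞} (hη : 0 < η) (h : ∀ n, η ≤ (νs n : Measure ℝ) {c n}) :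
    ¬ Tendsto νs atTop (𝓝 ν) := by
  intro hlim
  obtain ⟨𝒞, hfin, hF, hcover⟩ := exists_finite_closed_cover_measure_lt (ν : Measure ℝ) hν hη
  -- Portmanteau on each closed set of the finite cover; the set containing `c n` then contradicts
  -- the mass of the atom.
  have hev : ∀ᶠ n in atTop, ∀ F ∈ 𝒞, (νs n : Measure ℝ) F < η := by
    refine (eventually_all_finite hfin).2 fun F hFC => ?_
    exact eventually_lt_of_limsup_lt
      ((ProbabilityMeasure.limsup_measure_closed_le_of_tendsto hlim (hF F hFC).1).trans_lt
        (hF F hFC).2)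
  obtain ⟨n, hn⟩ := hev.exists
  obtain ⟨F, hFC, hcF⟩ : c n ∈ ⋃₀ 𝒞 := hcover ▸ Set.mem_univ _
  exact ((h n).trans (measure_mono (Set.singleton_subset_iff.2 hcF))).not_gt (hn F hFC)

/-! ### The tail functional of a variable with Gaussian type tails -/

section Tail

variable {Ω : Type*} [MeasurableSpace Ω] {P : Measure Ω} {Y : Ω → ℝ} {C : ℝ≥0∞}

lemma tailG_eq_lintegral
    (hY : ∀ s : ℝ, 0 < s → P {ω | s < |Y ω|} = C * ENNReal.ofReal (Real.exp (-s ^ 2)))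
    {r : ℝ} (hr : 0 ≤ r) :
    tailG P Y r = C * ∫⁻ t in Set.Ioi (0 : ℝ), ENNReal.ofReal (t * Real.exp (-(t + r) ^ 2)) := by
  unfold tailG
  rw [← lintegral_const_mul _ (by fun_prop)]
  refine setLIntegral_congr_fun measurableSet_Ioi fun t (ht : 0 < t) => ?_
  rw [hY _ (by positivity), ENNReal.ofReal_mul ht.le, mul_left_comm]

lemma tailG_pos (hC : C ≠ 0)
    (hY : ∀ s : ℝ, 0 < s → P {ω | s < |Y ω|} = C * ENNReal.ofReal (Real.exp (-s ^ 2)))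
    {r : ℝ} (hr : 0 ≤ r) : 0 < tailG P Y r := by
  rw [tailG_eq_lintegral hY hr]
  refine ENNReal.mul_pos hC (ne_of_gt ?_)
  rw [setLIntegral_pos_iff (by fun_prop)]
  have : Set.Ioi (0 : ℝ) ⊆ Function.support
      (fun t : ℝ => ENNReal.ofReal (t * Real.exp (-(t + r) ^ 2))) := by
    intro t (ht : 0 < t)
    simpa using mul_pos ht (Real.exp_pos _)
  rw [Set.inter_eq_right.2 this]
  simp

lemma tailG_lt_top (hC : C ≠ ∞)
    (hY : ∀ s : ℝ, 0 < s → P {ω | s < |Y ω|} = C * ENNReal.ofReal (Real.exp (-s ^ 2)))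
    {r : ℝ} (hr : 0 ≤ r) : tailG P Y r < ∞ := by
  rw [tailG_eq_lintegral hY hr]
  refine ENNReal.mul_lt_top hC.lt_top (lt_of_le_of_lt ?_
    (integrable_mul_exp_neg_mul_sq one_pos).lintegral_lt_top)
  refine (setLIntegral_mono (by fun_prop) fun t (ht : 0 < t) => ?_).trans
    (setLIntegral_le_lintegral (Set.Ioi 0) _)
  gcongr
  nlinarith [mul_nonneg ht.le hr]

lemma tailG_add_le
    (hY : ∀ s : ℝ, 0 < s → P {ω | s < |Y ω|} = C * ENNReal.ofReal (Real.exp (-s ^ 2)))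
    {r ε : ℝ} (hr : 0 ≤ r) (hε : 0 ≤ ε) :
    tailG P Y (r + ε) ≤ ENNReal.ofReal (Real.exp (-(ε * r))) * tailG P Y r := by
  rw [tailG_eq_lintegral hY hr, tailG_eq_lintegral hY (by positivity), mul_left_comm,
    ← lintegral_const_mul (ENNReal.ofReal (Real.exp (-(ε * r)))) (by fun_prop)]
  refine mul_le_mul_right (setLIntegral_mono' measurableSet_Ioi fun t (ht : 0 < t) => ?_) _
  rw [← ENNReal.ofReal_mul (Real.exp_pos _).le, mul_left_comm, ← Real.exp_add]
  gcongr
  -- The exponents compare because `(t + r + ε)² = (t + r)² + 2ε(t + r) + ε² ≥ (t + r)² + εr`.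
  nlinarith [mul_nonneg ht.le hε, mul_nonneg hr hε, sq_nonneg ε]

lemma tendsto_tailG_div
    (hY : ∀ s : ℝ, 0 < s → P {ω | s < |Y ω|} = C * ENNReal.ofReal (Real.exp (-s ^ 2)))
    {ε : ℝ} (hε : 0 < ε) :
    Tendsto (fun r : ℝ => tailG P Y (r + ε) / tailG P Y r) atTop (𝓝 0) := by
  have hlim : Tendsto (fun r : ℝ => ENNReal.ofReal (Real.exp (-(ε * r)))) atTop (𝓝 0) := by
    rw [← ENNReal.ofReal_zero]
    exact ENNReal.tendsto_ofReal (Real.tendsto_exp_neg_atTop_nhds_zero.comp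
      (tendsto_id.const_mul_atTop hε))
  refine tendsto_of_tendsto_of_tendsto_of_le_of_le' tendsto_const_nhds hlim
    (Eventually.of_forall fun _ => zero_le) ?_
  filter_upwards [eventually_ge_atTop 0] with r hr
  exact ENNReal.div_le_of_le_mul (tailG_add_le hY hr hε.le)

end Tail

/-! ### Coefficients of independent σ-fields -/

lemma rhoCoeff_eq_zero_of_indep {Ω : Type*} {𝒜 ℬ : MeasurableSpace Ω} {mΩ : MeasurableSpace Ω}
    {P : Measure Ω} (h : Indep 𝒜 ℬ P) : rhoCoeff 𝒜 ℬ P = 0 := by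
  have key : ∀ f g : Ω → ℝ, Measurable[𝒜] f → MemLp f 2 P → Measurable[ℬ] g → MemLp g 2 P →
      |corr P f g| = 0 := by
    intro f g hf hf2 hg hg2
    have hfg : IndepFun f g P := (IndepFun_iff_Indep f g P).2
      (indep_of_indep_of_le_left (indep_of_indep_of_le_right h hg.comap_le) hf.comap_le)
    simp [corr, hfg.covariance_eq_zero hf2 hg2]
  refine le_antisymm (Real.sSup_nonpos ?_) (Real.sSup_nonneg ?_)
  · rintro x ⟨f, g, hf, hf2, hg, hg2, rfl⟩
    exact (key f g hf hf2 hg hg2).le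
  · rintro x ⟨f, g, -, -, -, -, rfl⟩
    exact abs_nonneg _

/-- If outside a set `E` the events of `ℬ` coincide with events of a σ-field independent of `𝒜`,
then `α(𝒜, ℬ) ≤ 2 P(E)`. -/
lemma alphaCoeff_le_of_indep_off {Ω : Type*} {𝒜 ℬ 𝒞 : MeasurableSpace Ω}
    {mΩ : MeasurableSpace Ω} {P : Measure Ω} [IsProbabilityMeasure P] (h : Indep 𝒜 𝒞 P)
    {E : Set Ω}
    (hE : ∀ B, MeasurableSet[ℬ] B → ∃ B', MeasurableSet[𝒞] B' ∧ ∀ ω ∉ E, ω ∈ B ↔ ω ∈ B') :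
    alphaCoeff 𝒜 ℬ P ≤ 2 * P.real E := by
  refine Real.sSup_le ?_ (by positivity)
  rintro x ⟨A, B, hA, hB, rfl⟩
  obtain ⟨B', hB', hBB'⟩ := hE B hB
  have hind : P.real (A ∩ B') = P.real A * P.real B' := by
    simp only [Measure.real, (Indep_iff _ _ P).1 h A B' hA hB', ENNReal.toReal_mul]
  have key : ∀ S T : Set Ω, (∀ ω ∉ E, ω ∈ S → ω ∈ T) → P.real S ≤ P.real T + P.real E := by
    intro S T hST
    refine (measureReal_mono (fun ω hω => ?_)).trans (measureReal_union_le T E)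
    by_cases hωE : ω ∈ E
    · exact Or.inr hωE
    · exact Or.inl (hST ω hωE hω)
  have h1 := key (A ∩ B) (A ∩ B') fun ω hω hS => ⟨hS.1, (hBB' ω hω).1 hS.2⟩
  have h2 := key (A ∩ B') (A ∩ B) fun ω hω hS => ⟨hS.1, (hBB' ω hω).2 hS.2⟩
  have h3 := key B B' fun ω hω => (hBB' ω hω).1
  have h4 := key B' B fun ω hω => (hBB' ω hω).2
  have hA0 : 0 ≤ P.real A := measureReal_nonneg
  have hA1 : P.real A ≤ 1 := measureReal_le_one
  have hE0 : 0 ≤ P.real E := measureReal_nonneg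
  -- Replacing `B` by `B'` costs `P(E)` in `P(A ∩ B)` and at most `P(A) P(E) ≤ P(E)` in the product.
  rw [abs_le]
  constructor <;> nlinarith

/-! ### Differences of isolated nonzero values -/

/-- The value at time `k`, kept only if the preceding value vanishes. -/
noncomputable def isolated (k : ℤ) (ω : ℤ → ℝ) : ℝ := if ω (k - 1) = 0 then ω k else 0

/-- The increment of the isolated values. -/
noncomputable def isolatedDiff (k : ℤ) (ω : ℤ → ℝ) : ℝ := isolated k ω - isolated (k - 1) ω

/-- If `ω (k - 1) = 0` the second factor vanishes, and otherwise the first does. -/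
lemma isolated_mul_isolated_pred (k : ℤ) (ω : ℤ → ℝ) :
    isolated k ω * isolated (k - 1) ω = 0 := by
  unfold isolated
  split_ifs <;> simp_all

lemma isolated_eq_zero {k : ℤ} {ω : ℤ → ℝ} (h : ω k = 0) : isolated k ω = 0 := by
  simp [isolated, h]

lemma shrunkenSum_isolatedDiff (r : ℝ) (n : ℕ) (ω : ℤ → ℝ) :
    shrunkenSum isolatedDiff r n ω = shrink r (isolated n ω) - shrink r (isolated 0 ω) := by
  unfold shrunkenSum
  induction n with
  | zero => simp
  | succ n ih =>
    rw [Finset.sum_Icc_succ_top (by omega), ih, isolatedDiff,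
      shrink_sub_of_mul_eq_zero _ (isolated_mul_isolated_pred _ _)]
    push_cast
    rw [add_sub_cancel_right]
    ring

lemma measurable_isolated {m : MeasurableSpace (ℤ → ℝ)} {k : ℤ}
    (h : Measurable[m] fun ω : ℤ → ℝ => ω k) (h' : Measurable[m] fun ω : ℤ → ℝ => ω (k - 1)) :
    Measurable[m] (isolated k) :=
  Measurable.ite (h' (measurableSet_singleton 0)) h measurable_const

lemma measurable_isolatedDiff {m : MeasurableSpace (ℤ → ℝ)} {k : ℤ}
    (h : ∀ j, k - 2 ≤ j → j ≤ k → Measurable[m] fun ω : ℤ → ℝ => ω j) :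
    Measurable[m] (isolatedDiff k) :=
  (measurable_isolated (h k (by omega) le_rfl) (h _ (by omega) (by omega))).sub
    (measurable_isolated (h _ (by omega) (by omega)) (h _ (by omega) (by omega)))

lemma measurable_eval_sigmaGen {S : Set ℤ} {k : ℤ} (hk : k ∈ S) :
    Measurable[sigmaGen (fun (k : ℤ) (ω : ℤ → ℝ) => ω k) S] fun ω : ℤ → ℝ => ω k :=
  Measurable.mono (comap_measurable _)
    (le_iSup₂ (f := fun (k : ℤ) (_ : k ∈ S) =>
      MeasurableSpace.comap (fun ω : ℤ → ℝ => ω k) inferInstance) k hk) le_rfl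

lemma sigmaGen_isolatedDiff_le (S : Set ℤ) :
    sigmaGen isolatedDiff S ≤
      sigmaGen (fun (k : ℤ) (ω : ℤ → ℝ) => ω k) {j | ∃ k ∈ S, k - 2 ≤ j ∧ j ≤ k} :=
  iSup₂_le fun k hk => (measurable_isolatedDiff fun _ h1 h2 =>
    measurable_eval_sigmaGen
      (S := {j | ∃ k ∈ S, k - 2 ≤ j ∧ j ≤ k}) ⟨k, hk, h1, h2⟩).comap_le

/-- Membership in an event of `σ(X_k, k ∈ S)` depends only on the values `X_k`, `k ∈ S`. -/
lemma mem_iff_mem_of_measurableSet_sigmaGen {Ω : Type*} {X : ℤ → Ω → ℝ} {S : Set ℤ} {B : Set Ω}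
    (hB : MeasurableSet[sigmaGen X S] B) {ω ω' : Ω} (h : ∀ k ∈ S, X k ω = X k ω') :
    ω ∈ B ↔ ω' ∈ B := by
  -- Every event of the σ-field is a preimage under the joint map `ω ↦ (X k ω)` for `k ∈ S`.
  have hle : sigmaGen X S ≤
      MeasurableSpace.comap (fun ω (k : S) => X k ω) MeasurableSpace.pi := by
    refine iSup₂_le fun k hk => ?_
    have h1 : Measurable[MeasurableSpace.comap (fun ω (k : S) => X k ω) MeasurableSpace.pi]
        (X k) :=
      (measurable_pi_apply (X := fun _ : S => ℝ) ⟨k, hk⟩).comp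
        (comap_measurable fun ω (k : S) => X k ω)
    exact h1.comap_le
  obtain ⟨B₀, -, rfl⟩ := hle B hB
  have : (fun k : S => X k ω) = fun k : S => X k ω' := funext fun k => h k k.2
  simp only [Set.mem_preimage, this]

/-- Replaces the values at nonpositive times by `0`. -/
noncomputable def eraseNonpos (ω : ℤ → ℝ) (k : ℤ) : ℝ := if 1 ≤ k then ω k else 0

/-- The times `k = 1, 2` could look back past time 1. They do so only through `ω 0`, which is
already `0`, and through `isolated 0`, which vanishes with `ω 0` whatever `ω (-1)` is. -/
lemma isolatedDiff_eraseNonpos {ω : ℤ → ℝ} (h0 : ω 0 = 0) {k : ℤ} (hk : 1 ≤ k) :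
    isolatedDiff k (eraseNonpos ω) = isolatedDiff k ω := by
  have hval : ∀ j, 0 ≤ j → eraseNonpos ω j = ω j := by
    intro j hj
    rcases hj.eq_or_lt with rfl | hj
    · simp [eraseNonpos, h0]
    · exact if_pos (by omega)
  have hiso : ∀ j, 0 ≤ j → isolated j (eraseNonpos ω) = isolated j ω := by
    intro j hj
    rcases hj.eq_or_lt with rfl | hj
    · rw [isolated_eq_zero h0, isolated_eq_zero (by rw [hval 0 le_rfl, h0])]
    · rw [isolated, isolated, hval _ hj.le, hval _ (by omega)]
  rw [isolatedDiff, isolatedDiff, hiso _ (by omega), hiso _ (by omega)]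

lemma measurable_eraseNonpos :
    Measurable[sigmaGen (fun (k : ℤ) (ω : ℤ → ℝ) => ω k) {j | 1 ≤ j}] eraseNonpos := by
  refine @measurable_pi_lambda _ _ _ (_) _ _ fun k => ?_
  by_cases hk : 1 ≤ k
  · simpa only [eraseNonpos, if_pos hk] using measurable_eval_sigmaGen (S := {j | 1 ≤ j}) hk
  · simp only [eraseNonpos, if_neg hk, measurable_const]

lemma measurableSet_lt_abs (s : ℝ) : MeasurableSet {x : ℝ | s < |x|} :=
  measurableSet_lt measurable_const continuous_abs.measurable

/-! ### The increments under a product measure -/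

section Product

variable (μ : Measure ℝ) [IsProbabilityMeasure μ]

/-- The law of a two-sided i.i.d. sequence with marginal `μ`. -/
noncomputable abbrev iidLaw : Measure (ℤ → ℝ) := Measure.infinitePi fun _ => μ

lemma indep_sigmaGen_eval {S T : Set ℤ} (hST : Disjoint S T) :
    Indep (sigmaGen (fun (k : ℤ) (ω : ℤ → ℝ) => ω k) S)
      (sigmaGen (fun (k : ℤ) (ω : ℤ → ℝ) => ω k) T) (iidLaw μ) :=
  indep_iSup_of_disjoint (fun k => (measurable_pi_apply k).comap_le)
    (iIndepFun_infinitePi (P := fun _ : ℤ => μ) (X := fun _ x => x)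
      fun _ => measurable_id).iIndep hST

lemma iidLaw_eval_mem {s : Set ℝ} (hs : MeasurableSet s) (k : ℤ) :
    iidLaw μ {ω | ω k ∈ s} = μ s := by
  rw [← (measurePreserving_eval_infinitePi (fun _ : ℤ => μ) k).measure_preimage
    hs.nullMeasurableSet]
  rfl

lemma iidLaw_eval_mem_and {s t : Set ℝ} (hs : MeasurableSet s) (ht : MeasurableSet t) {j k : ℤ}
    (hjk : j ≠ k) : iidLaw μ {ω | ω j ∈ s ∧ ω k ∈ t} = μ s * μ t := by
  rw [← Measure.prod_prod, ← Measure.infinitePi_map_eval_prod (P := fun _ : ℤ => μ) hjk,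
    Measure.map_apply (by fun_prop) (hs.prod ht)]
  rfl

lemma strictlyStationary_isolatedDiff : StrictlyStationary (iidLaw μ) isolatedDiff := by
  have hmeas : Measurable fun (ω : ℤ → ℝ) (k : ℤ) => isolatedDiff k ω :=
    measurable_pi_lambda _ fun k => measurable_isolatedDiff fun j _ _ => measurable_pi_apply j
  have key : ∀ (j : ℤ) (m : ℕ),
      (iidLaw μ).map (fun ω => fun i : Fin (m + 1) => isolatedDiff (j + (i : ℤ)) ω) =
        (iidLaw μ).map (fun ω => fun i : Fin (m + 1) => isolatedDiff (i : ℤ) ω) := by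
    intro j m
    have hshift := Measure.map_infinitePi_infinitePi_of_inj (P := fun _ : ℤ => μ)
      (add_right_injective j)
    -- The product law is invariant under the shift by `j`, and the increments commute with shifts.
    conv_rhs => rw [iidLaw, ← hshift]
    rw [Measure.map_map (f := fun (ω : ℤ → ℝ) (i : ℤ) => ω (j + i))
      (g := fun ω (i : Fin (m + 1)) => isolatedDiff (i : ℤ) ω)
      (measurable_pi_lambda _ fun i => (measurable_pi_apply _).comp hmeas) (by fun_prop)]
    congr 1
    ext ω i
    simp only [Function.comp_apply, isolatedDiff, isolated, add_sub_assoc]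
  intro j l m
  rw [key j m, key l m]

lemma rhoStar_isolatedDiff_eq_zero {n : ℕ} (hn : 3 ≤ n) :
    rhoStar (iidLaw μ) isolatedDiff n = 0 := by
  have key : ∀ S T : Set ℤ, (∀ s ∈ S, ∀ t ∈ T, (n : ℤ) ≤ |s - t|) →
      rhoCoeff (sigmaGen isolatedDiff S) (sigmaGen isolatedDiff T) (iidLaw μ) = 0 := by
    intro S T hST
    refine rhoCoeff_eq_zero_of_indep (indep_of_indep_of_le_left (indep_of_indep_of_le_right
      (indep_sigmaGen_eval μ ?_) (sigmaGen_isolatedDiff_le T)) (sigmaGen_isolatedDiff_le S))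
    rw [Set.disjoint_left]
    rintro j ⟨s, hs, h1, h2⟩ ⟨t, ht, h3, h4⟩
    have h5 := hST s hs t ht
    -- A coordinate shared by the windows `[s - 2, s]` and `[t - 2, t]` forces this.
    have h6 : |s - t| ≤ 2 := abs_le.2 ⟨by omega, by omega⟩
    omega
  refine le_antisymm (Real.sSup_nonpos ?_) (Real.sSup_nonneg ?_) <;>
  · rintro x ⟨S, T, -, -, -, hST, rfl⟩
    simp [key S T hST]

lemma alphaMix_isolatedDiff_le :
    alphaMix (iidLaw μ) isolatedDiff 1 ≤ 2 * μ.real {0}ᶜ := by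
  have hE : (iidLaw μ).real {ω | ω 0 ∈ ({0}ᶜ : Set ℝ)} = μ.real {0}ᶜ := by
    rw [Measure.real, iidLaw_eval_mem μ (measurableSet_singleton 0).compl, Measure.real]
  have hle : sigmaGen isolatedDiff {k | k ≤ 0} ≤
      sigmaGen (fun (k : ℤ) (ω : ℤ → ℝ) => ω k) {j | j ≤ 0} := by
    refine (sigmaGen_isolatedDiff_le _).trans (biSup_mono ?_)
    rintro j ⟨k, hk, -, hjk⟩
    exact hjk.trans hk
  have hdisj : Disjoint {j : ℤ | j ≤ 0} {j : ℤ | 1 ≤ j} := by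
    rw [Set.disjoint_left]
    intro j (h1 : j ≤ 0) (h2 : 1 ≤ j)
    omega
  rw [← hE]
  refine alphaCoeff_le_of_indep_off
    (indep_of_indep_of_le_left (indep_sigmaGen_eval μ hdisj) hle) fun B hB => ?_
  have hB' : MeasurableSet B :=
    iSup₂_le (fun k _ => (measurable_isolatedDiff (k := k)
      fun j _ _ => measurable_pi_apply j).comap_le) B hB
  -- Erasing the nonpositive coordinates turns `B` into an event of the strict future, and
  -- membership is unchanged where `ω 0 = 0`.
  refine ⟨eraseNonpos ⁻¹' B, measurable_eraseNonpos hB', fun ω hω => ?_⟩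
  have h0 : ω 0 = 0 := by simpa using hω
  exact mem_iff_mem_of_measurableSet_sigmaGen hB fun k hk =>
    (isolatedDiff_eraseNonpos h0 (by simpa using hk)).symm

lemma le_real_shrunkenSum_isolatedDiff_eq_zero (r : ℝ) (n : ℕ) :
    1 - 2 * μ.real {0}ᶜ ≤ (iidLaw μ).real {ω | shrunkenSum isolatedDiff r n ω = 0} := by
  have hreal : ∀ k : ℤ, (iidLaw μ).real {ω | ω k ∈ ({0}ᶜ : Set ℝ)} = μ.real {0}ᶜ := by
    intro k
    rw [Measure.real, iidLaw_eval_mem μ (measurableSet_singleton 0).compl, Measure.real]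
  have hcover : (Set.univ : Set (ℤ → ℝ)) ⊆ {ω | shrunkenSum isolatedDiff r n ω = 0} ∪
      ({ω | ω n ∈ ({0}ᶜ : Set ℝ)} ∪ {ω | ω 0 ∈ ({0}ᶜ : Set ℝ)}) := by
    intro ω _
    by_cases hn : ω n = 0
    · by_cases h0 : ω 0 = 0
      · left
        simp [shrunkenSum_isolatedDiff, isolated_eq_zero hn, isolated_eq_zero h0]
      · exact Or.inr (Or.inr h0)
    · exact Or.inr (Or.inl hn)
  have h1 := (measureReal_mono hcover (μ := iidLaw μ)).trans (measureReal_union_le _ _)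
  have h2 := measureReal_union_le (μ := iidLaw μ) {ω | ω n ∈ ({0}ᶜ : Set ℝ)}
    {ω | ω 0 ∈ ({0}ᶜ : Set ℝ)}
  rw [hreal, hreal] at h2
  rw [probReal_univ] at h1
  linarith

lemma iidLaw_lt_abs_isolatedDiff_zero {s : ℝ} (hs : 0 < s) :
    iidLaw μ {ω | s < |isolatedDiff 0 ω|} = 2 * μ {0} * μ {x | s < |x|} := by
  have hm := measurableSet_lt_abs s
  have hev : ∀ k : ℤ, Measurable fun ω : ℤ → ℝ => ω k := fun k => measurable_pi_apply k
  have hset : {ω : ℤ → ℝ | s < |isolatedDiff 0 ω|} =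
      {ω | ω 0 ∈ {x : ℝ | s < |x|} ∧ ω (-1) ∈ ({0} : Set ℝ)} ∪
        {ω | ω (-1) ∈ {x : ℝ | s < |x|} ∧ ω (-2) ∈ ({0} : Set ℝ)} := by
    ext ω
    have e1 : isolated 0 ω = if ω (-1) = 0 then ω 0 else 0 := rfl
    have e2 : isolated (0 - 1) ω = if ω (-2) = 0 then ω (-1) else 0 := rfl
    simp only [isolatedDiff, e1, e2, Set.mem_ofPred_eq, Set.mem_union, Set.mem_singleton_iff]
    -- The value of `ω (-1)` decides which of the two terms can be nonzero; this also makes the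
    -- union disjoint and yields the factor 2.
    by_cases h1 : ω (-1) = 0
    · simp [h1, hs.not_gt]
    · by_cases h2 : ω (-2) = 0 <;> simp [h1, h2, hs.not_gt]
  rw [hset, measure_union, iidLaw_eval_mem_and μ hm (measurableSet_singleton 0) (by decide),
    iidLaw_eval_mem_and μ hm (measurableSet_singleton 0) (by decide)]
  · ring
  · rw [Set.disjoint_left]
    rintro ω ⟨-, h1⟩ ⟨h2, -⟩
    rw [Set.mem_singleton_iff] at h1
    simp [h1, hs.not_gt] at h2
  · exact .inter (hev (-1) hm) (hev (-2) (measurableSet_singleton 0))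

end Product

/-! ### A noise law vanishing with large probability -/

/-- The law that is `0` with probability `1 - p` and otherwise the square root of a standard
exponential variable. -/
noncomputable def noiseLaw (p : ℝ) : Measure ℝ :=
  ENNReal.ofReal (1 - p) • Measure.dirac 0 + ENNReal.ofReal p • (expMeasure 1).map Real.sqrt

lemma map_sqrt_expMeasure_tail {s : ℝ} (hs : 0 ≤ s) :
    (expMeasure 1).map Real.sqrt {x | s < |x|} = ENNReal.ofReal (Real.exp (-s ^ 2)) := by
  have := isProbabilityMeasure_expMeasure one_pos
  have hset : Real.sqrt ⁻¹' {x | s < |x|} = (Set.Iic (s ^ 2))ᶜ := by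
    ext x
    simp [abs_of_nonneg (Real.sqrt_nonneg x), Real.lt_sqrt hs]
  rw [Measure.map_apply Real.continuous_sqrt.measurable
    (measurableSet_lt_abs s), hset, ← ofReal_measureReal,
    probReal_compl_eq_one_sub measurableSet_Iic, ← cdf_eq_real, cdf_expMeasure_eq one_pos,
    if_pos (sq_nonneg s)]
  simp

section NoiseLaw

variable {p : ℝ}

lemma isProbabilityMeasure_noiseLaw (h0 : 0 ≤ p) (h1 : p ≤ 1) :
    IsProbabilityMeasure (noiseLaw p) := by
  have := isProbabilityMeasure_expMeasure one_pos
  have := Measure.isProbabilityMeasure_map (μ := expMeasure 1)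
    Real.continuous_sqrt.measurable.aemeasurable
  constructor
  simp [noiseLaw, ← ENNReal.ofReal_add (sub_nonneg.2 h1) h0]

lemma noiseLaw_tail {s : ℝ} (hs : 0 ≤ s) :
    noiseLaw p {x | s < |x|} = ENNReal.ofReal p * ENNReal.ofReal (Real.exp (-s ^ 2)) := by
  have hm := measurableSet_lt_abs s
  simp [noiseLaw, map_sqrt_expMeasure_tail hs, Measure.dirac_apply' _ hm, hs.not_gt]

lemma noiseLaw_compl_zero : noiseLaw p {0}ᶜ = ENNReal.ofReal p := by
  have : ({0}ᶜ : Set ℝ) = {x | 0 < |x|} := by ext x; simp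
  rw [this, noiseLaw_tail le_rfl]
  simp

lemma noiseLaw_zero (h0 : 0 ≤ p) (h1 : p ≤ 1) : noiseLaw p {0} = ENNReal.ofReal (1 - p) := by
  have := isProbabilityMeasure_noiseLaw h0 h1
  rw [← compl_compl ({0} : Set ℝ), prob_compl_eq_one_sub (measurableSet_singleton 0).compl,
    noiseLaw_compl_zero, ENNReal.ofReal_sub _ h0, ENNReal.ofReal_one]

end NoiseLaw

/-- If the shrunken sums vanish with probability bounded away from zero, then their affine
normalizations do not converge in distribution to a nondegenerate normal law. -/
lemma not_tendstoInDistribution_gaussianReal {Ω : Type*} [MeasurableSpace Ω] {P : Measure Ω}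
    [IsProbabilityMeasure P] {S : ℕ → Ω → ℝ} {η : ℝ} (hη : 0 < η)
    (hS : ∀ n, η ≤ P.real {ω | S n ω = 0}) (a b : ℕ → ℝ) (m : ℝ) {v : ℝ≥0} (hv : v ≠ 0) :
    ¬ TendstoInDistribution (fun (n : ℕ) (ω : Ω) => a n * S n ω - b n) atTop
        (fun x : ℝ => x) (fun _ : ℕ => P) (gaussianReal m v) := by
  intro h
  have := nullSingletonClass_gaussianReal (μ := m) hv
  refine not_tendsto_of_le_measure_singleton (c := fun n => -b n) (η := ENNReal.ofReal η)
    ?_ (ENNReal.ofReal_pos.2 hη) ?_ h.tendsto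
  · intro x
    change (gaussianReal m v).map id {x} = 0
    rw [Measure.map_id, measure_singleton]
  · intro n
    change _ ≤ P.map (fun ω => a n * S n ω - b n) {-b n}
    rw [Measure.map_apply_of_aemeasurable (h.forall_aemeasurable n) (measurableSet_singleton _)]
    refine (ENNReal.ofReal_le_of_le_toReal (hS n)).trans (measure_mono ?_)
    -- Where the sum vanishes, the normalized variable equals `-b n`, whatever `a n` is.
    intro ω (hω : S n ω = 0)
    simp [hω]

end Shrunken

theorem theorem2p2 (lam : ℝ) (hlam0 : 0 < lam) (hlam1 : lam < 1) :
    ∃ (Ω : Type) (_ : MeasurableSpace Ω) (P : Measure Ω) (_ : IsProbabilityMeasure P)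
      (X : ℤ → Ω → ℝ),
      (∀ k, Measurable (X k)) ∧
      Shrunken.StrictlyStationary P X ∧
      (∀ r : ℝ, 0 ≤ r → 0 < Shrunken.tailG P (X 0) r ∧ Shrunken.tailG P (X 0) r < ∞) ∧
      (∀ ε : ℝ, 0 < ε →
        Tendsto (fun r : ℝ => Shrunken.tailG P (X 0) (r + ε) / Shrunken.tailG P (X 0) r)
          atTop (𝓝 0)) ∧
      Shrunken.alphaMix P X 1 ≤ lam ∧
      (∃ c : ℝ, 0 < c ∧
        (fun n : ℕ => Shrunken.rhoStar P X n) =O[atTop] (fun n : ℕ => Real.exp (-c * (n : ℝ)))) ∧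
      (∀ r : ℝ, 0 < r → ∀ n : ℕ, 1 ≤ n →
        1 - lam ≤ P.real {ω | Shrunken.shrunkenSum X r n ω = 0}) ∧
      (∀ (r a b : ℕ → ℝ), (∀ n, 0 < r n) → ∀ (m : ℝ) (v : ℝ≥0), v ≠ 0 →
        ¬ TendstoInDistribution
            (fun (n : ℕ) (ω : Ω) => a n * Shrunken.shrunkenSum X (r n) n ω - b n) atTop
            (fun x : ℝ => x) (fun _ : ℕ => P) (gaussianReal m v)) := by
  -- Noise parameter `p = λ / 2`: the mixing bound and the probability of a nonzero sum are both at
  -- most `2p`.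
  have hp0 : 0 < lam / 2 := by positivity
  have hp1 : lam / 2 < 1 := by linarith
  have := Shrunken.isProbabilityMeasure_noiseLaw hp0.le hp1.le
  set μ := Shrunken.noiseLaw (lam / 2) with hμ
  have hreal : 2 * μ.real {0}ᶜ = lam := by
    rw [Measure.real, hμ, Shrunken.noiseLaw_compl_zero, ENNReal.toReal_ofReal hp0.le]
    ring
  set C : ℝ≥0∞ := 2 * ENNReal.ofReal (1 - lam / 2) * ENNReal.ofReal (lam / 2) with hC
  have hC0 : C ≠ 0 := by
    simp only [hC, ne_eq, mul_eq_zero, ENNReal.ofReal_eq_zero, not_or, not_le]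
    exact ⟨⟨two_ne_zero, by linarith⟩, hp0⟩
  have hCtop : C ≠ ∞ :=
    ENNReal.mul_ne_top (ENNReal.mul_ne_top (by simp) ENNReal.ofReal_ne_top) ENNReal.ofReal_ne_top
  have htail : ∀ s : ℝ, 0 < s → Shrunken.iidLaw μ {ω | s < |Shrunken.isolatedDiff 0 ω|} =
      C * ENNReal.ofReal (Real.exp (-s ^ 2)) := by
    intro s hs
    rw [Shrunken.iidLaw_lt_abs_isolatedDiff_zero μ hs, hμ, Shrunken.noiseLaw_tail hs.le,
      Shrunken.noiseLaw_zero hp0.le hp1.le, hC]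
    ring
  have hzero : ∀ (r : ℝ) (n : ℕ), 1 - lam ≤
      (Shrunken.iidLaw μ).real {ω | Shrunken.shrunkenSum Shrunken.isolatedDiff r n ω = 0} := by
    intro r n
    rw [← hreal]
    exact Shrunken.le_real_shrunkenSum_isolatedDiff_eq_zero μ r n
  refine ⟨ℤ → ℝ, inferInstance, Shrunken.iidLaw μ, inferInstance, Shrunken.isolatedDiff,
    fun k => Shrunken.measurable_isolatedDiff fun j _ _ => measurable_pi_apply j,
    Shrunken.strictlyStationary_isolatedDiff μ,
    fun r hr => ⟨Shrunken.tailG_pos hC0 htail hr, Shrunken.tailG_lt_top hCtop htail hr⟩,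
    fun ε hε => Shrunken.tendsto_tailG_div htail hε,
    hreal ▸ Shrunken.alphaMix_isolatedDiff_le μ, ⟨1, one_pos, ?_⟩,
    fun r _ n _ => hzero r n,
    fun r a b _ m v hv => Shrunken.not_tendstoInDistribution_gaussianReal
      (S := fun n => Shrunken.shrunkenSum Shrunken.isolatedDiff (r n) n)
      (sub_pos.2 hlam1) (fun n => hzero (r n) n) a b m hv⟩
  -- The coefficient is eventually zero, so the rate `c = 1` is arbitrary.
  have hev : (fun n : ℕ => Shrunken.rhoStar (Shrunken.iidLaw μ) Shrunken.isolatedDiff n)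
      =ᶠ[atTop] fun _ => (0 : ℝ) :=
    (eventually_ge_atTop 3).mono fun n hn => Shrunken.rhoStar_isolatedDiff_eq_zero μ hn
  exact hev.trans_isBigO (Asymptotics.isBigO_zero _ _)
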